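/- Let $N\ge 1$ and $k\ge 2$ be integers and $\chi$ a Dirichlet character modulo $N$. Let $M_k(N,\chi)$ be the space of modular forms of weight $k$ and character $\chi$ on $\Gamma_0(N)$, and let $E_k(N,\chi)\subseteq M_k(N,\chi)$ be the Eisenstein subspace (the orthogonal complement of the cusp forms under the Petersson product). For primitive Dirichlet characters $\psi_1,\psi_2$ modulo $N_1,N_2$ put $$E(\psi_1,\psi_2,k)(z)=\frac{\delta(\psi_1)}{2}L(1-k,\psi_2)+\sum_{n\ge 1}\Big(\sum_{d\mid n}\psi_1(n/d)\,\psi_2(d)\,d^{k-1}\Big)q^n,\qquad q=e^{2\pi i z},$$ where $\delta(\psi_1)=1$ if $\psi_1$ is principal and $\delta(\psi_1)=0$ otherwise. A newform decomposition of $E\in E_k(N,\chi)$ is an expression $$E(z)=\sum_{i=1}^m c_i\,E_i(d_iz),\qquad c_i\in\mathbf C\setminus\{0\},\quad E_i=E(\psi_{i,1},\psi_{i,2},k),$$ with distinct triples $(\psi_{i,1},\psi_{i,2},d_i)$, where $\psi_{i,1},\psi_{i,2}$ are primitive of moduli $N_{i,1},N_{i,2}$, the product $\psi_{i,1}\psi_{i,2}$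 induces $\chi$ modulo $N$, and $d_i\ge 1$ satisfies $N_{i,1}N_{i,2}d_i\mid N$. (If $k=2$ and $\chi$ is principal, the formal series $E(1,1,2)$ is allowed as an $E_i$.) Let $E(\chi,\chi_0,k)$ denote the series attached to the primitive character inducing $\chi$ and to the principal character $\chi_0$ modulo $1$. Theorem. Let $E\in E_k(N,\chi)$ be nonzero with rational Fourier coefficients, and suppose that no shift of $E(\chi,\chi_0,k)$ occurs in the newform decomposition of $E$, that is, $E$ has a newform decomposition in which every $E_i$ is different from $E(\chi,\chi_0,k)$. Then $E$ has negative Fourier coefficients of arbitrarily large absolute value: for every real $B$ there is $n$ with $a_E(n)<0$ and $|a_E(n)|>B$. -/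

import Mathlib

open scoped MatrixGroups ModularForm UpperHalfPlane

namespace EisensteinSigns

noncomputable section

/-- `σ_{χ₁,χ₂}^{k-1}(n) = ∑_{d ∣ n} χ₁(n/d) χ₂(d) d^{k-1}` for `n ≥ 1` (and `0` at `n = 0`). -/
def twistedSigma {N₁ N₂ : ℕ} (χ₁ : DirichletCharacter ℂ N₁) (χ₂ : DirichletCharacter ℂ N₂)
    (k n : ℕ) : ℂ :=
  ∑ d ∈ n.divisors, χ₁ ((n / d : ℕ) : ZMod N₁) * χ₂ (d : ZMod N₂) * (d : ℂ) ^ (k - 1)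

open Classical in
/-- The Eisenstein series `E(χ₁,χ₂,k)(z) = (δ(χ₁)/2) L(1-k,χ₂) + ∑_{n ≥ 1} σ_{χ₁,χ₂}^{k-1}(n) qⁿ`,
with `q = e^{2πiz}`, where `δ(χ₁) = 1` if `χ₁` is principal and `δ(χ₁) = 0` otherwise. -/
def eisensteinE {N₁ N₂ : ℕ} [NeZero N₂] (χ₁ : DirichletCharacter ℂ N₁)
    (χ₂ : DirichletCharacter ℂ N₂) (k : ℕ) (z : ℍ) : ℂ :=
  (if χ₁ = 1 then 1 else 0) / 2 * χ₂.LFunction (1 - (k : ℂ)) +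
    ∑' n : ℕ, twistedSigma χ₁ χ₂ k n * Complex.exp (2 * Real.pi * Complex.I * z) ^ n

/-- The shift operator `(f ∣ B_d)(z) = f(dz)`. -/
def shift (d : ℕ+) (f : ℍ → ℂ) (z : ℍ) : ℂ :=
  f ((⟨(d : ℝ), Nat.cast_pos.mpr d.pos⟩ : {x : ℝ // 0 < x}) • z)

/-- `f ∈ M_k(N,χ)`: the modular forms `f` of weight `k` on `Γ₁(N)` such that
`f ∣[k] γ = χ(d) f` for all `γ = (a, b; c, d) ∈ Γ₀(N)`. -/
def HasNebentypus {N k : ℕ} (χ : DirichletCharacter ℂ N)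
    (f : ModularForm (CongruenceSubgroup.Gamma1 N) k) : Prop :=
  ∀ γ ∈ CongruenceSubgroup.Gamma0 N, (f : ℍ → ℂ) ∣[(k : ℤ)] γ = χ (γ 1 1 : ZMod N) • (f : ℍ → ℂ)

/-- The Petersson product `∫_{Γ₀(N)\ℍ} f ḡ y^k dμ`, `dμ = dx dy / y²`. The quotient `Γ₀(N)\ℍ` is
represented by the translates `g⁻¹ 𝒟` of the standard fundamental domain `𝒟` of `SL₂(ℤ)`, where
`g` runs through representatives of `SL₂(ℤ)/Γ₀(N)`. -/
def peterssonProduct (N k : ℕ) (f g : ℍ → ℂ) : ℂ :=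
  ∑ᶠ q : SL(2, ℤ) ⧸ CongruenceSubgroup.Gamma0 N,
    ∫ z in ModularGroup.fd, UpperHalfPlane.petersson k g f ((Quotient.out q)⁻¹ • z)

/-- `f ∈ E_k(N,χ)`: `f` lies in `M_k(N,χ)` and is orthogonal to all cusp forms in `M_k(N,χ)`. -/
def IsEisenstein {N k : ℕ} (χ : DirichletCharacter ℂ N)
    (f : ModularForm (CongruenceSubgroup.Gamma1 N) k) : Prop :=
  HasNebentypus χ f ∧
    ∀ g : ModularForm (CongruenceSubgroup.Gamma1 N) k, HasNebentypus χ g →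
      ModularForm.IsCuspForm g → peterssonProduct N k f g = 0

/-- An Eisenstein newform `E(ψ₁,ψ₂,k)` of level `N₁N₂ ∣ N` and character inducing `χ` modulo `N`,
together with a divisor `d` of `N / (N₁N₂)`. -/
structure ShiftedNewform {N : ℕ} (χ : DirichletCharacter ℂ N) where
  N₁ : ℕ+
  N₂ : ℕ+
  ψ₁ : DirichletCharacter ℂ N₁
  ψ₂ : DirichletCharacter ℂ N₂
  d : ℕ+
  primitive₁ : ψ₁.IsPrimitive
  primitive₂ : ψ₂.IsPrimitive
  dvd : (N₁ * N₂ * d : ℕ) ∣ N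
  character : DirichletCharacter.changeLevel (((dvd_mul_right _ _).mul_right _).trans dvd) ψ₁ *
    DirichletCharacter.changeLevel (((dvd_mul_left _ _).mul_right _).trans dvd) ψ₂ = χ

/-- The newform `E(ψ₁,ψ₂,k)`. -/
def ShiftedNewform.newform {N : ℕ} {χ : DirichletCharacter ℂ N} (i : ShiftedNewform χ) (k : ℕ) :
    ℍ → ℂ :=
  eisensteinE i.ψ₁ i.ψ₂ k

/-- `f = ∑ cᵢ (Eᵢ ∣ B_{dᵢ})` is the decomposition of `f` into shifts of newforms of level dividing
`N`. For `k = 2` and `χ` principal the formal series `E(1,1,2)` is also allowed as an `Eᵢ`, as it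
has to be in order that forms such as `E(1,1,2)(z) - 2 E(1,1,2)(2z)` can be decomposed. -/
def IsNewformDecomposition {N : ℕ} {χ : DirichletCharacter ℂ N} (k : ℕ) (f : ℍ → ℂ)
    (c : ShiftedNewform χ →₀ ℂ) : Prop :=
  f = c.sum fun i a ↦ a • shift i.d (i.newform k)

/-- `E(χ,χ₀,k)`, with `χ₀` the principal character modulo `1` and `χ` replaced by the primitive
character that induces it. Its coefficients are `∑_{d ∣ n} χ(n/d) d^{k-1}`. -/
def principalNewform {N : ℕ} (χ : DirichletCharacter ℂ N) (k : ℕ) : ℍ → ℂ :=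
  eisensteinE χ.primitiveCharacter (1 : DirichletCharacter ℂ 1) k

/-- No shift of `E(χ,χ₀,k)` appears in the newform decomposition of `f`. -/
def NoPrincipalShift {N : ℕ} (χ : DirichletCharacter ℂ N) (k : ℕ) (f : ℍ → ℂ) : Prop :=
  ∃ c : ShiftedNewform χ →₀ ℂ, IsNewformDecomposition k f c ∧
    ∀ i ∈ c.support, i.newform k ≠ principalNewform χ k

/-- The `n`-th Fourier coefficient of `f`, for the expansion in powers of `q = e^{2πiz}`. -/
def fourierCoeff (f : ℍ → ℂ) (n : ℕ) : ℂ :=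
  (UpperHalfPlane.qExpansion 1 f).coeff n

end

end EisensteinSigns

namespace EisensteinSigns

/-! Let a(m) be the coefficients of E and suppose they are bounded below. For fixed m ≥ 1 and primes
p ≡ u mod N not dividing m, multiplicativity of the twisted divisor sums gives a(pm) = A(u) +
p^(k-1) b(u), where b is a combination of the characters ψ₂ and b(1) = a(m)
(`ShiftedNewform.coeff_prime_mul`). Dirichlet's theorem lets p grow within each unit class, so Re
b(u) ≥ 0. Excluding shifts of E(χ,χ₀,k) makes every ψ₂ nontrivial mod N
(`ShiftedNewform.changeLevel_ψ₂_ne_one`), so b sums to 0 over ℤ/N. Hence Re b = 0, and rationality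
gives a(m) = 0. Then E is constant, so zero in positive weight (`eq_zero_of_const`). -/

theorem norm_twistedSigma_le {N₁ N₂ : ℕ} (χ₁ : DirichletCharacter ℂ N₁)
    (χ₂ : DirichletCharacter ℂ N₂) (k n : ℕ) :
    ‖twistedSigma χ₁ χ₂ k n‖ ≤ (n : ℝ) ^ (k - 1 + 1) := by
  calc ‖twistedSigma χ₁ χ₂ k n‖
      ≤ ∑ d ∈ n.divisors, (n : ℝ) ^ (k - 1) := by
        refine norm_sum_le_of_le _ fun d hd ↦ ?_
        rw [norm_mul, norm_mul, norm_pow, Complex.norm_natCast]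
        have hdn : (d : ℝ) ≤ n := by exact_mod_cast Nat.divisor_le hd
        have h₁ := χ₁.norm_le_one ((n / d : ℕ) : ZMod N₁)
        have h₂ := χ₂.norm_le_one (d : ZMod N₂)
        calc _ ≤ 1 * 1 * (n : ℝ) ^ (k - 1) := by gcongr
          _ = _ := by ring
    _ = n.divisors.card * (n : ℝ) ^ (k - 1) := by simp
    _ ≤ n * (n : ℝ) ^ (k - 1) := by
        gcongr
        exact n.card_divisors_le_self
    _ = (n : ℝ) ^ (k - 1 + 1) := by ring

theorem summable_twistedSigma_mul_pow {N₁ N₂ : ℕ} (χ₁ : DirichletCharacter ℂ N₁)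
    (χ₂ : DirichletCharacter ℂ N₂) (k : ℕ) {q : ℂ} (hq : ‖q‖ < 1) :
    Summable fun n : ℕ ↦ twistedSigma χ₁ χ₂ k n * q ^ n := by
  refine .of_norm_bounded (summable_norm_pow_mul_geometric_of_norm_lt_one (k - 1 + 1) hq)
    fun n ↦ ?_
  rw [norm_mul, norm_mul, norm_pow (n : ℂ), Complex.norm_natCast]
  gcongr
  exact norm_twistedSigma_le ..

theorem twistedSigma_prime_mul {N₁ N₂ : ℕ} (χ₁ : DirichletCharacter ℂ N₁)
    (χ₂ : DirichletCharacter ℂ N₂) (k : ℕ) {p m : ℕ} (hp : p.Prime) (hpm : ¬ p ∣ m) :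
    twistedSigma χ₁ χ₂ k (p * m) =
      twistedSigma χ₁ χ₂ k m * (χ₁ (p : ZMod N₁) + χ₂ (p : ZMod N₂) * (p : ℂ) ^ (k - 1)) := by
  have hdiv : (p * m).divisors = m.divisors ∪ m.divisors.image (p * ·) := by
    ext d
    simp [Nat.divisors_mul, hp.divisors, Finset.mem_mul]
  have hdisj : Disjoint m.divisors (m.divisors.image (p * ·)) := by
    refine Finset.disjoint_left.mpr fun d hd hd' ↦ ?_
    obtain ⟨e, -, rfl⟩ := Finset.mem_image.mp hd'
    exact hpm ((dvd_mul_right p e).trans (Nat.dvd_of_mem_divisors hd))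
  rw [twistedSigma, hdiv, Finset.sum_union hdisj, Finset.sum_image
    fun a _ b _ h ↦ Nat.eq_of_mul_eq_mul_left hp.pos h, twistedSigma, mul_add,
    Finset.sum_mul, Finset.sum_mul]
  congr 1
  · refine Finset.sum_congr rfl fun d hd ↦ ?_
    rw [Nat.mul_div_assoc p (Nat.dvd_of_mem_divisors hd), Nat.cast_mul, map_mul]
    ring
  · refine Finset.sum_congr rfl fun d _ ↦ ?_
    rw [Nat.mul_div_mul_left _ _ hp.pos, Nat.cast_mul, Nat.cast_mul, map_mul]
    ring

/-- The `m`-th coefficient of the shifted Eisenstein newform `i`. -/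
noncomputable def ShiftedNewform.coeff {N : ℕ} {χ : DirichletCharacter ℂ N} (i : ShiftedNewform χ)
    (k m : ℕ) : ℂ :=
  if (i.d : ℕ) ∣ m then twistedSigma i.ψ₁ i.ψ₂ k (m / i.d) else 0

-- The constant term `a` is kept apart because `i.coeff k 0 = 0`: `Nat.divisors 0` is empty.
open Classical in
theorem ShiftedNewform.hasSum_shift {N : ℕ} {χ : DirichletCharacter ℂ N} (i : ShiftedNewform χ)
    (k : ℕ) : ∃ a : ℂ, ∀ z : ℍ,
      HasSum (fun m : ℕ ↦ ((if m = 0 then a else 0) + i.coeff k m) *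
        Function.Periodic.qParam 1 z ^ m) (shift i.d (i.newform k) z) := by
  refine ⟨(if i.ψ₁ = 1 then 1 else 0) / 2 * i.ψ₂.LFunction (1 - (k : ℂ)), fun z ↦ ?_⟩
  simp only [add_mul]
  unfold shift newform eisensteinE
  refine HasSum.add ?_ ?_
  · refine (hasSum_ite_eq (0 : ℕ) _).congr_fun fun m ↦ ?_
    split_ifs with hm <;> simp [hm]
  · set w : ℍ := (⟨(i.d : ℝ), Nat.cast_pos.mpr i.d.pos⟩ : {x : ℝ // 0 < x}) • z
    have hw : Complex.exp (2 * Real.pi * Complex.I * w) =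
        Function.Periodic.qParam 1 z ^ (i.d : ℕ) := by
      rw [Function.Periodic.qParam, ← Complex.exp_nat_mul]
      congr 1
      simp [w, UpperHalfPlane.coe_pos_real_smul]
      ring
    have hs := (summable_twistedSigma_mul_pow i.ψ₁ i.ψ₂ k
      (UpperHalfPlane.norm_exp_two_pi_I_lt_one w)).hasSum
    have hinj : Function.Injective fun n : ℕ ↦ (i.d : ℕ) * n :=
      fun a b h ↦ Nat.eq_of_mul_eq_mul_left i.d.pos h
    rw [← hinj.hasSum_iff]
    · convert hs using 2 with n
      simp [coeff, hw, pow_mul]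
    · intro m hm
      have : ¬ (i.d : ℕ) ∣ m := fun ⟨n, hn⟩ ↦ hm ⟨n, hn.symm⟩
      simp [coeff, this]

theorem IsNewformDecomposition.exists_hasSum {N : ℕ} {χ : DirichletCharacter ℂ N} {k : ℕ}
    {f : ℍ → ℂ} {c : ShiftedNewform χ →₀ ℂ} (hf : IsNewformDecomposition k f c) :
    ∃ a : ℂ, ∀ z : ℍ, HasSum (fun m : ℕ ↦ ((if m = 0 then a else 0) +
      ∑ i ∈ c.support, c i * i.coeff k m) * Function.Periodic.qParam 1 z ^ m) (f z) := by
  choose a ha using fun i : ShiftedNewform χ ↦ i.hasSum_shift k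
  refine ⟨∑ i ∈ c.support, c i * a i, fun z ↦ ?_⟩
  have h := hasSum_sum fun i (_ : i ∈ c.support) ↦ (ha i z).mul_left (c i)
  rw [hf, Finsupp.sum]
  simp only [Finset.sum_apply, Pi.smul_apply, smul_eq_mul]
  refine h.congr_fun fun m ↦ ?_
  rw [add_mul, Finset.sum_mul]
  split_ifs
  · simp only [Finset.sum_mul, ← Finset.sum_add_distrib]
    exact Finset.sum_congr rfl fun i _ ↦ by ring
  · simp only [zero_add, zero_mul]
    exact Finset.sum_congr rfl fun i _ ↦ by ring

theorem ShiftedNewform.dvd_level₁ {N : ℕ} {χ : DirichletCharacter ℂ N} (i : ShiftedNewform χ) :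
    (i.N₁ : ℕ) ∣ N :=
  ((dvd_mul_right _ _).mul_right _).trans i.dvd

theorem ShiftedNewform.dvd_level₂ {N : ℕ} {χ : DirichletCharacter ℂ N} (i : ShiftedNewform χ) :
    (i.N₂ : ℕ) ∣ N :=
  ((dvd_mul_left _ _).mul_right _).trans i.dvd

theorem ShiftedNewform.coeff_prime_mul {N : ℕ} {χ : DirichletCharacter ℂ N} (i : ShiftedNewform χ)
    (k : ℕ) {p m : ℕ} (hp : p.Prime) (hpm : ¬ p ∣ m) {u : (ZMod N)ˣ} (hpu : (p : ZMod N) = u) :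
    i.coeff k (p * m) = i.coeff k m * (DirichletCharacter.changeLevel i.dvd_level₁ i.ψ₁ u +
      DirichletCharacter.changeLevel i.dvd_level₂ i.ψ₂ u * (p : ℂ) ^ (k - 1)) := by
  have hpN : p.Coprime N := (ZMod.isUnit_iff_coprime p N).mp (hpu ▸ u.isUnit)
  have hd : (i.d : ℕ).Coprime p :=
    (hpN.coprime_dvd_right ((dvd_mul_left _ _).trans i.dvd)).symm
  simp only [coeff, hd.dvd_mul_left]
  split_ifs with h
  · rw [Nat.mul_div_assoc _ h, twistedSigma_prime_mul _ _ _ hp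
      fun h' ↦ hpm (h'.trans (Nat.div_dvd_of_dvd h)),
      DirichletCharacter.changeLevel_eq_cast_of_dvd, DirichletCharacter.changeLevel_eq_cast_of_dvd,
      ← hpu, ZMod.cast_natCast i.dvd_level₁, ZMod.cast_natCast i.dvd_level₂]
  · simp

/-- Level change preserves the conductor and is injective. The sigma type is needed since the two
moduli agree only propositionally. -/
theorem eq_primitiveCharacter_of_changeLevel_eq {M N : ℕ} [NeZero N] {ψ : DirichletCharacter ℂ M}
    (hψ : ψ.IsPrimitive) {χ : DirichletCharacter ℂ N} (hM : M ∣ N)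
    (h : DirichletCharacter.changeLevel hM ψ = χ) :
    (⟨M, ψ⟩ : Σ n, DirichletCharacter ℂ n) = ⟨χ.conductor, χ.primitiveCharacter⟩ := by
  have hcond : χ.conductor = M := by
    rw [← h, DirichletCharacter.conductor_changeLevel, hψ]
  have key : ∀ {n : ℕ} (φ : DirichletCharacter ℂ n) (hn : n ∣ N),
      DirichletCharacter.changeLevel hn φ = χ → n = M →
      (⟨M, ψ⟩ : Σ n, DirichletCharacter ℂ n) = ⟨n, φ⟩ := by
    rintro n φ hn hφ rfl
    rw [DirichletCharacter.changeLevel_injective hM (h.trans hφ.symm)]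
  exact key _ _ χ.changeLevel_primitiveCharacter hcond

/-- If ψ₂ were trivial mod N, primitivity would force N₂ = 1, and then ψ₁ would be the primitive
character inducing χ. -/
theorem ShiftedNewform.changeLevel_ψ₂_ne_one {N : ℕ} [NeZero N] {χ : DirichletCharacter ℂ N}
    {i : ShiftedNewform χ} {k : ℕ} (hi : i.newform k ≠ principalNewform χ k) :
    DirichletCharacter.changeLevel i.dvd_level₂ i.ψ₂ ≠ 1 := by
  obtain ⟨N₁, N₂, ψ₁, ψ₂, d, h₁, h₂, hd, hχ⟩ := i
  intro h
  rw [h, mul_one] at hχ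
  rw [DirichletCharacter.changeLevel_eq_one_iff,
    DirichletCharacter.eq_one_iff_conductor_eq_one, h₂] at h
  obtain rfl : N₂ = 1 := PNat.coe_injective h
  refine hi ?_
  have h₁' := eq_primitiveCharacter_of_changeLevel_eq h₁ _ hχ
  have hψ₂ : ψ₂ = (1 : DirichletCharacter ℂ 1) := DirichletCharacter.level_one ψ₂
  subst hψ₂
  exact congrArg (fun φ : Σ n, DirichletCharacter ℂ n ↦
    eisensteinE φ.2 (1 : DirichletCharacter ℂ 1) k) h₁'

theorem eq_zero_of_const {N k : ℕ} [NeZero N] (hk : k ≠ 0)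
    (f : ModularForm (CongruenceSubgroup.Gamma1 N) k) {a : ℂ} (hf : ∀ z, f z = a) : f = 0 := by
  suffices a = 0 by ext z; simp [hf, this]
  -- At z = i the automorphy factor is (1 + Ni)^k, which equals 1 only if 1 + N² = 1.
  let γ : SL(2, ℤ) := ⟨!![1, 0; (N : ℤ), 1], by simp⟩
  have hγ : γ ∈ CongruenceSubgroup.Gamma1 N := by
    rw [CongruenceSubgroup.Gamma1_mem]
    simp [γ]
  have h := SlashInvariantForm.slash_action_eqn_SL'' f hγ UpperHalfPlane.I
  rw [hf, hf] at h
  by_contra ha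
  have h1 : (UpperHalfPlane.denom γ UpperHalfPlane.I) ^ (k : ℤ) = 1 :=
    mul_right_cancel₀ ha (by rw [← h, one_mul])
  rw [zpow_natCast] at h1
  have h2 : ‖UpperHalfPlane.denom γ UpperHalfPlane.I‖ = 1 :=
    (pow_eq_one_iff_of_nonneg (norm_nonneg _) hk).mp (by rw [← norm_pow, h1, norm_one])
  have h3 : Complex.normSq (UpperHalfPlane.denom γ UpperHalfPlane.I) = 1 := by
    rw [Complex.normSq_eq_norm_sq, h2, one_pow]
  rw [ModularGroup.denom_apply] at h3
  simp [γ, Complex.normSq_apply] at h3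
  exact NeZero.ne N h3

theorem nonneg_of_frequently_le_add_mul_pow {A B C : ℝ} {j : ℕ} (hj : j ≠ 0)
    (h : ∀ n : ℕ, ∃ p > n, C ≤ A + (p : ℝ) ^ j * B) : 0 ≤ B := by
  by_contra! hB
  obtain ⟨n, hn⟩ := exists_nat_gt ((C - A) / B)
  obtain ⟨p, hp, hC⟩ := h n
  have hp1 : (1 : ℝ) ≤ p := by exact_mod_cast Nat.one_le_of_lt hp
  have hnp : (n : ℝ) ≤ (p : ℝ) ^ j :=
    (Nat.cast_le.mpr hp.le).trans (le_self_pow₀ hp1 hj)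
  have := (div_lt_iff_of_neg hB).mp (hn.trans_le hnp)
  linarith

theorem sum_coeff_eq_zero_of_bddBelow {N k : ℕ} [NeZero N] (hk : 2 ≤ k) {χ : DirichletCharacter ℂ N}
    {c : ShiftedNewform χ →₀ ℂ}
    (hc : ∀ i ∈ c.support, DirichletCharacter.changeLevel i.dvd_level₂ i.ψ₂ ≠ 1) {C : ℝ}
    (hC : ∀ n ≠ 0, C ≤ (∑ i ∈ c.support, c i * i.coeff k n).re) {m : ℕ} (hm : m ≠ 0) :
    (∑ i ∈ c.support, c i * i.coeff k m).re = 0 := by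
  let b (u : ZMod N) : ℂ := ∑ i ∈ c.support,
    c i * i.coeff k m * DirichletCharacter.changeLevel i.dvd_level₂ i.ψ₂ u
  have hb_nonneg (u : ZMod N) : 0 ≤ (b u).re := by
    by_cases hu : IsUnit u
    · obtain ⟨u, rfl⟩ := hu
      refine nonneg_of_frequently_le_add_mul_pow (j := k - 1) (C := C) (A := (∑ i ∈ c.support,
        c i * i.coeff k m * DirichletCharacter.changeLevel i.dvd_level₁ i.ψ₁ u).re)
        (by omega) fun n ↦ ?_
      -- Taking p > m ensures p ∤ m.
      obtain ⟨p, hpn, hp, hpu⟩ := Nat.forall_exists_prime_gt_and_eq_mod u.isUnit (max n m)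
      rw [gt_iff_lt, max_lt_iff] at hpn
      refine ⟨p, hpn.1, (hC (p * m) (mul_ne_zero hp.ne_zero hm)).trans_eq ?_⟩
      have hpm : ¬ p ∣ m := Nat.not_dvd_of_pos_of_lt (Nat.pos_of_ne_zero hm) hpn.2
      rw [← Complex.re_ofReal_mul, ← Complex.add_re]
      congr 1
      push_cast
      rw [Finset.mul_sum, ← Finset.sum_add_distrib]
      refine Finset.sum_congr rfl fun i _ ↦ ?_
      rw [i.coeff_prime_mul k hp hpm hpu]
      ring
    · simp [b, MulChar.map_nonunit _ hu]
  have hb_sum : ∑ u, b u = 0 := by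
    rw [Finset.sum_comm]
    refine Finset.sum_eq_zero fun i hi ↦ ?_
    rw [← Finset.mul_sum, MulChar.sum_eq_zero_of_ne_one (hc i hi), mul_zero]
  have hb_re : ∑ u, (b u).re = 0 := by rw [← Complex.re_sum, hb_sum, Complex.zero_re]
  -- Nonnegative reals with sum 0 all vanish; the value at u = 1 is the m-th coefficient.
  have h1 := (Finset.sum_eq_zero_iff_of_nonneg fun u _ ↦ hb_nonneg u).mp hb_re 1 (Finset.mem_univ _)
  simpa [b] using h1

end EisensteinSigns

theorem mainTheorem9 (N k : ℕ) [NeZero N] (hk : 2 ≤ k) (χ : DirichletCharacter ℂ N)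
    (E : ModularForm (CongruenceSubgroup.Gamma1 N) k)
    (hE : EisensteinSigns.IsEisenstein χ E) (hE0 : E ≠ 0)
    (hrat : ∀ n : ℕ, ∃ r : ℚ, EisensteinSigns.fourierCoeff E n = r)
    (hno : EisensteinSigns.NoPrincipalShift χ k E) :
    ∀ B : ℝ, ∃ (n : ℕ) (r : ℚ),
      EisensteinSigns.fourierCoeff E n = r ∧ r < 0 ∧ B < |(r : ℝ)| := by
  intro B
  by_contra! hB
  obtain ⟨c, hc, hprin⟩ := hno
  obtain ⟨a, ha⟩ := hc.exists_hasSum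
  have hcoeff {n : ℕ} (hn : n ≠ 0) :
      EisensteinSigns.fourierCoeff E n = ∑ i ∈ c.support, c i * i.coeff k n := by
    rw [EisensteinSigns.fourierCoeff, ← ModularFormClass.qExpansion_coeff_unique
      (Γ := CongruenceSubgroup.Gamma1 N) (k := k) one_pos (by simp) ha n]
    simp [hn]
  -- The absolute value covers B < 0, where -B would not bound the nonnegative coefficients.
  have hbdd (n : ℕ) (hn : n ≠ 0) : -|B| ≤ (∑ i ∈ c.support, c i * i.coeff k n).re := by
    obtain ⟨r, hr⟩ := hrat n
    rw [← hcoeff hn, hr, Complex.ratCast_re]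
    rcases lt_or_ge r 0 with h | h
    · exact neg_le_of_abs_le ((hB n r hr h).trans (le_abs_self B))
    · exact (neg_nonpos.mpr (abs_nonneg B)).trans (by exact_mod_cast h)
  have hzero {n : ℕ} (hn : n ≠ 0) : ∑ i ∈ c.support, c i * i.coeff k n = 0 := by
    have hre := EisensteinSigns.sum_coeff_eq_zero_of_bddBelow hk
      (fun i hi ↦ EisensteinSigns.ShiftedNewform.changeLevel_ψ₂_ne_one (hprin i hi)) hbdd hn
    obtain ⟨r, hr⟩ := hrat n
    rw [← hcoeff hn, hr, Complex.ratCast_re] at hre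
    rw [← hcoeff hn, hr]
    exact_mod_cast hre
  refine hE0 (EisensteinSigns.eq_zero_of_const (by omega) E
    (a := a + ∑ i ∈ c.support, c i * i.coeff k 0) fun z ↦ (ha z).unique ?_)
  convert hasSum_single 0 fun m hm ↦ ?_
  · simp
  · simp [hm, hzero hm]
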